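/- Let $K\ge 1$, $[K]=\{1,\dots,K\}$, $\Delta=\{\theta\in\mathbb R^K:\theta_k\ge 0,\ \sum_k\theta_k=1\}$, $\epsilon>0$, $\kappa\in(0,1)$, $\epsilon_1=\kappa\epsilon$. *Mechanism.* For $\Omega\subseteq[K]$, $x\in\Omega$, let $\mathrm{SRR}(x;\Omega,e)$ output $x$ with probability $e^{e}/(e^{e}+|\Omega|-1)$ and otherwise a uniform element of $\Omega\setminus\{x\}$. For $S\subsetneq[K]$ let $\epsilon_2=\min\{\epsilon,\ln\frac{|S^c|-1}{e^{\epsilon_1-\epsilon}|S^c|-1}\}$ if $\epsilon-\epsilon_1<\ln|S^c|$ and $S\neq\emptyset$, and $\epsilon_2=\epsilon$ otherwise. $\mathrm{RRRR}(x;S,\epsilon)$ draws $R$ uniformly from $S^c$ and outputs $\mathrm{SRR}(x;S\cup\{R\},\epsilon_1)$ if $x\in S$; if $x\notin S$ it draws $R=\mathrm{SRR}(x;S^c,\epsilon_2)$ and outputs $\mathrm{SRR}(R;S\cup\{R\},\epsilon_1)$. Let $g_{S,\epsilon}(y|x)$ be the probability that it outputs $y$ on input $x$, and $h_{S,\epsilon}(y|\theta)=\sum_x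 g_{S,\epsilon}(y|x)\theta_x$. *Subset selection.* Let $U(\theta,S,\epsilon)\in\mathbb R$ be a utility function. For $\theta\in\Delta$ let $\sigma_\theta$ be a permutation of $[K]$ with $\theta_{\sigma_\theta(1)}\ge\dots\ge\theta_{\sigma_\theta(K)}$, $S_{k,\theta}=\{\sigma_\theta(1),\dots,\sigma_\theta(k)\}$, $k^*_\theta\in\arg\max_{0\le k\le K-1}U(\theta,S_{k,\theta},\epsilon)$ and $S^*_\theta=S_{k^*_\theta,\theta}$, with ties broken by any fixed rule for which $\theta\mapsto S^*_\theta$ is measurable. *Algorithm with exact posterior sampling.* Let $\eta$ be a probability density on $\Delta$ with respect to Lebesgue measure $d\theta$ in the first $K-1$ coordinates, and $$\Pi(A\mid y_{1:n},s_{1:n})=\frac{\int_A\eta(\theta)\prod_{t=1}^n h_{s_t,\epsilon}(y_t|\theta)\,d\theta}{\int_\Delta\eta(\theta)\prod_{t=1}^n h_{s_t,\epsilon}(y_t|\theta)\,d\theta}.$$ Fix $\theta^*,\theta_{\rm init}\in\Delta$. Start with $\Theta_0=\theta_{\rm init}$; for $t=1,2,\dots$ set $S_t=S^*_{\Theta_{t-1}}$,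 draw $Y_t$ from $h_{S_t,\epsilon}(\cdot|\theta^*)$ and then $\Theta_t$ from $\Pi(\cdot\mid Y_{1:t},S_{1:t})$. Let $P_{\theta^*}$ be the resulting law, $E_{\theta^*}$ its expectation, and $S^*=S^*_{\theta^*}$. **Theorem.** Assume: 1. there are $d,B>0$ such that $\eta(\theta')>0$ and $\eta(\theta)/\eta(\theta')<B$ for all $\theta,\theta'\in\Delta$ with $\|\theta'-\theta^*\|_2<d$; 2. $\theta^*_{\sigma_{\theta^*}(1)}>\dots>\theta^*_{\sigma_{\theta^*}(K)}$; 3. for every $S\subsetneq[K]$, $\theta\mapsto U(\theta,S,\epsilon)$ is continuous on $\Delta$; 4. the maximizer of $k\mapsto U(\theta^*,S_{k,\theta^*},\epsilon)$ over $\{0,\dots,K-1\}$ is unique. Then $$\lim_{n\to\infty}P_{\theta^*}(S_n=S^*)=1,\qquad\text{and consequently}\qquad \lim_{n\to\infty}\frac1n\sum_{t=1}^n E_{\theta^*}\big[\mathbb I(S_t=S^*)\big]=1 .$$ -/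

import Mathlib

open MeasureTheory ProbabilityTheory Filter Topology
open scoped ENNReal

noncomputable section

namespace AdOBEst

/-- The probability simplex of probability vectors on `K` categories. -/
abbrev Simplex (K : ℕ) : Type := stdSimplex ℝ (Fin K)

/-- Probability that the standard randomized response on the set `Ω` with parameter `e` and input
`x ∈ Ω` outputs `y`: the input is reported with probability `exp e / (exp e + |Ω| - 1)`, otherwise
the output is uniform on `Ω \ {x}`. -/
def srr {K : ℕ} (Ω : Finset (Fin K)) (e : ℝ) (x y : Fin K) : ℝ :=
  let p := Real.exp e / (Real.exp e + (Ω.card : ℝ) - 1)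
  if y = x then p else if y ∈ Ω then (1 - p) * (1 / ((Ω.card : ℝ) - 1)) else 0

/-- The second privacy parameter of the mechanism, as a function of `ε`, `ε₁` and the subset. -/
def eps2 {K : ℕ} (ε ε₁ : ℝ) (S : Finset (Fin K)) : ℝ :=
  if ε - ε₁ < Real.log (Sᶜ.card : ℝ) ∧ 0 < S.card then
    min ε (Real.log (((Sᶜ.card : ℝ) - 1) / (Real.exp (ε₁ - ε) * (Sᶜ.card : ℝ) - 1)))
  else ε

/-- Probability `g_{S,ε}(y | x)` that the randomly restricted randomized response with subset `S`,
`ε₁ = κ ε` and `ε₂ = eps2 ε ε₁ S` outputs `y` on input `x`: an element `r` of `Sᶜ` is drawn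
(uniformly if `x ∈ S`, by a randomized response of `x` on `Sᶜ` otherwise), and then `x`
(respectively `r`) goes through a randomized response on `S ∪ {r}`. -/
def rrrr {K : ℕ} (ε κ : ℝ) (S : Finset (Fin K)) (y x : Fin K) : ℝ :=
  if x ∈ S then ∑ r ∈ Sᶜ, (1 / (Sᶜ.card : ℝ)) * srr (insert r S) (κ * ε) x y
  else ∑ r ∈ Sᶜ, srr Sᶜ (eps2 ε (κ * ε) S) x r * srr (insert r S) (κ * ε) r y

/-- Marginal probability `h_{S,ε}(y | θ)` of the response `y` when the input has law `θ`. -/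
def marginal {K : ℕ} (ε κ : ℝ) (S : Finset (Fin K)) (y : Fin K) (θ : Simplex K) : ℝ :=
  ∑ x, rrrr ε κ S y x * θ x

/-- The first `K - 1` coordinates of a probability vector. -/
def freeCoords {K : ℕ} (θ : Simplex K) : Fin (K - 1) → ℝ :=
  fun i => θ (Fin.castLE (Nat.sub_le K 1) i)

/-- The measure `dθ` on the simplex: Lebesgue measure in the first `K - 1` coordinates. -/
def simplexVolume (K : ℕ) : Measure (Simplex K) :=
  (volume : Measure (Fin (K - 1) → ℝ)).comap freeCoords

/-- A prior given by a probability density with respect to `dθ`. -/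
structure Prior (K : ℕ) where
  density : Simplex K → ℝ
  measurable_density : Measurable density
  density_nonneg : ∀ θ, 0 ≤ density θ
  lintegral_density : ∫⁻ θ, ENNReal.ofReal (density θ) ∂(simplexVolume K) = 1

/-- Prior times likelihood of the responses `y` obtained with the subsets `s`, as a measure. -/
def posteriorWeight {K : ℕ} (ε κ : ℝ) (η : Prior K) {ι : Type} [Fintype ι]
    (s : ι → Finset (Fin K)) (y : ι → Fin K) : Measure (Simplex K) :=
  (simplexVolume K).withDensity
    fun θ => ENNReal.ofReal (η.density θ * ∏ i, marginal ε κ (s i) (y i) θ)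

/-- The posterior distribution given the responses `y` obtained with the subsets `s`. -/
def posterior {K : ℕ} (ε κ : ℝ) (η : Prior K) {ι : Type} [Fintype ι]
    (s : ι → Finset (Fin K)) (y : ι → Fin K) : Measure (Simplex K) :=
  (posteriorWeight ε κ η s y Set.univ)⁻¹ • posteriorWeight ε κ η s y

/-- The set `{σ(1), …, σ(k)}` of the first `k` categories in the order `σ`. -/
def topSet {K : ℕ} (σ : Equiv.Perm (Fin K)) (k : Fin K) : Finset (Fin K) :=
  (Finset.univ.filter fun i => i < k).image σ

/-- A rule `θ ↦ S*_θ` that selects the best subset for the utility `U`: `σ θ` sorts the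
components of `θ` in non-increasing order and `k θ ∈ {0, …, K-1}` maximizes
`k ↦ U(θ, {σ_θ(1), …, σ_θ(k)}, ε)`. Ties may be broken in any (measurable) way. -/
structure SelectionRule {K : ℕ} (U : Simplex K → Finset (Fin K) → ℝ → ℝ) (ε : ℝ) where
  σ : Simplex K → Equiv.Perm (Fin K)
  k : Simplex K → Fin K
  sorted : ∀ θ : Simplex K, Antitone fun i => θ (σ θ i)
  maximal : ∀ (θ : Simplex K) (j : Fin K), U θ (topSet (σ θ) j) ε ≤ U θ (topSet (σ θ) (k θ)) ε
  measurable_topSet : Measurable fun θ => topSet (σ θ) (k θ)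

/-- The best subset `S*_θ`. -/
def SelectionRule.best {K : ℕ} {U : Simplex K → Finset (Fin K) → ℝ → ℝ} {ε : ℝ}
    (R : SelectionRule U ε) (θ : Simplex K) : Finset (Fin K) :=
  topSet (R.σ θ) (R.k θ)

/-! ### Facts that make the transition probabilities below well defined -/

lemma topSet_ne_univ {K : ℕ} (σ : Equiv.Perm (Fin K)) (k : Fin K) :
    topSet σ k ≠ Finset.univ := by
  intro h
  have : σ k ∈ topSet σ k := by rw [h]; exact Finset.mem_univ _
  simp [topSet] at this

lemma srr_denom_pos {K : ℕ} {Ω : Finset (Fin K)} {x : Fin K} (hx : x ∈ Ω) (e : ℝ) :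
    0 < Real.exp e + (Ω.card : ℝ) - 1 := by
  have h1 : (1 : ℝ) ≤ Ω.card := by exact_mod_cast Finset.card_pos.mpr ⟨x, hx⟩
  have := Real.exp_pos e
  linarith

lemma srr_pos {K : ℕ} {Ω : Finset (Fin K)} {x y : Fin K} (hx : x ∈ Ω) (hy : y ∈ Ω) (e : ℝ) :
    0 < srr Ω e x y := by
  have hd := srr_denom_pos hx e
  unfold srr
  by_cases hxy : y = x
  · simp only [hxy, if_true]
    exact div_pos (Real.exp_pos e) hd
  · simp only [hxy, if_false, hy, if_true]
    have h2 : (1 : ℝ) < Ω.card := by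
      exact_mod_cast Finset.one_lt_card.mpr ⟨y, hy, x, hx, hxy⟩
    apply mul_pos
    · rw [sub_pos, div_lt_one hd]; linarith
    · exact one_div_pos.mpr (by linarith)

lemma srr_nonneg {K : ℕ} {Ω : Finset (Fin K)} {x : Fin K} (hx : x ∈ Ω) (y : Fin K) (e : ℝ) :
    0 ≤ srr Ω e x y := by
  by_cases hy : y ∈ Ω
  · exact (srr_pos hx hy e).le
  · have hxy : y ≠ x := fun h => hy (h ▸ hx)
    simp [srr, hxy, hy]

lemma srr_eq_zero {K : ℕ} {Ω : Finset (Fin K)} {x y : Fin K} (hx : x ∈ Ω) (hy : y ∉ Ω) (e : ℝ) :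
    srr Ω e x y = 0 := by
  have hxy : y ≠ x := fun h => hy (h ▸ hx)
  simp [srr, hxy, hy]

lemma srr_sum {K : ℕ} {Ω : Finset (Fin K)} {x : Fin K} (hx : x ∈ Ω) (e : ℝ) :
    ∑ y ∈ Ω, srr Ω e x y = 1 := by
  have hd := srr_denom_pos hx e
  rw [← Finset.add_sum_erase _ _ hx]
  have h1 : ∀ y ∈ Ω.erase x, srr Ω e x y =
      (1 - Real.exp e / (Real.exp e + (Ω.card : ℝ) - 1)) * (1 / ((Ω.card : ℝ) - 1)) := by
    intro y hy
    rw [Finset.mem_erase] at hy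
    simp [srr, hy.1, hy.2]
  rw [Finset.sum_congr rfl h1, Finset.sum_const, Finset.card_erase_of_mem hx, nsmul_eq_mul,
    Nat.cast_sub (Finset.card_pos.mpr ⟨x, hx⟩), Nat.cast_one]
  have h2 : srr Ω e x x = Real.exp e / (Real.exp e + (Ω.card : ℝ) - 1) := by simp [srr]
  rw [h2]
  by_cases hc : (Ω.card : ℝ) - 1 = 0
  · have : Real.exp e + (Ω.card : ℝ) - 1 = Real.exp e := by linarith
    rw [hc, this, div_self (Real.exp_pos e).ne']
    simp
  · field_simp
    ring

lemma srr_sum_univ {K : ℕ} {Ω : Finset (Fin K)} {x : Fin K} (hx : x ∈ Ω) (e : ℝ) :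
    ∑ y, srr Ω e x y = 1 := by
  rw [← srr_sum hx e]
  exact (Finset.sum_subset (Finset.subset_univ Ω) fun y _ hy => srr_eq_zero hx hy e).symm

lemma compl_nonempty {K : ℕ} {S : Finset (Fin K)} (hS : S ≠ Finset.univ) : Sᶜ.Nonempty := by
  rw [Finset.nonempty_iff_ne_empty, ne_eq, Finset.compl_eq_empty_iff]
  exact hS

lemma rrrr_pos {K : ℕ} (ε κ : ℝ) {S : Finset (Fin K)} (hS : S ≠ Finset.univ) (y x : Fin K) :
    0 < rrrr ε κ S y x := by
  have hne := compl_nonempty hS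
  have hc : (0 : ℝ) < 1 / (Sᶜ.card : ℝ) := by
    apply one_div_pos.mpr; exact_mod_cast hne.card_pos
  obtain ⟨r₀, hr₀, hy⟩ : ∃ r ∈ Sᶜ, y ∈ insert r S := by
    by_cases hy : y ∈ S
    · exact ⟨hne.choose, hne.choose_spec, Finset.mem_insert_of_mem hy⟩
    · exact ⟨y, Finset.mem_compl.mpr hy, Finset.mem_insert_self _ _⟩
  unfold rrrr
  split_ifs with hx
  · apply Finset.sum_pos'
    · intro r _
      exact mul_nonneg hc.le (srr_nonneg (Finset.mem_insert_of_mem hx) _ _)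
    · exact ⟨r₀, hr₀, mul_pos hc (srr_pos (Finset.mem_insert_of_mem hx) hy _)⟩
  · have hx' := Finset.mem_compl.mpr hx
    apply Finset.sum_pos'
    · intro r _
      exact mul_nonneg (srr_nonneg hx' _ _) (srr_nonneg (Finset.mem_insert_self _ _) _ _)
    · exact ⟨r₀, hr₀, mul_pos (srr_pos hx' hr₀ _) (srr_pos (Finset.mem_insert_self _ _) hy _)⟩

lemma rrrr_sum {K : ℕ} (ε κ : ℝ) {S : Finset (Fin K)} (hS : S ≠ Finset.univ) (x : Fin K) :
    ∑ y, rrrr ε κ S y x = 1 := by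
  have hne := compl_nonempty hS
  have hc : (Sᶜ.card : ℝ) ≠ 0 := by exact_mod_cast hne.card_pos.ne'
  unfold rrrr
  split_ifs with hx
  · rw [Finset.sum_comm]
    simp_rw [← Finset.mul_sum, srr_sum_univ (Finset.mem_insert_of_mem hx)]
    rw [Finset.sum_const, nsmul_eq_mul, mul_one, one_div_mul_cancel hc]
  · rw [Finset.sum_comm]
    simp_rw [← Finset.mul_sum, srr_sum_univ (Finset.mem_insert_self _ _), mul_one]
    exact srr_sum (Finset.mem_compl.mpr hx) _

lemma simplex_sum {K : ℕ} (θ : Simplex K) : ∑ x, θ x = 1 := θ.2.2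

lemma simplex_nonneg {K : ℕ} (θ : Simplex K) (x : Fin K) : 0 ≤ θ x := θ.2.1 x

lemma marginal_pos {K : ℕ} (ε κ : ℝ) {S : Finset (Fin K)} (hS : S ≠ Finset.univ) (y : Fin K)
    (θ : Simplex K) : 0 < marginal ε κ S y θ := by
  have hsum := simplex_sum θ
  obtain ⟨x, hx⟩ : ∃ x, θ x ≠ 0 := by
    by_contra! h
    simp [h] at hsum
  apply Finset.sum_pos'
  · intro z _
    exact mul_nonneg (rrrr_pos ε κ hS y z).le (simplex_nonneg θ z)
  · exact ⟨x, Finset.mem_univ _,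
      mul_pos (rrrr_pos ε κ hS y x) (lt_of_le_of_ne (simplex_nonneg θ x) hx.symm)⟩

lemma marginal_sum {K : ℕ} (ε κ : ℝ) {S : Finset (Fin K)} (hS : S ≠ Finset.univ)
    (θ : Simplex K) : ∑ y, marginal ε κ S y θ = 1 := by
  unfold marginal
  rw [Finset.sum_comm]
  simp_rw [← Finset.sum_mul, rrrr_sum ε κ hS, one_mul]
  exact simplex_sum θ

lemma marginal_le_one {K : ℕ} (ε κ : ℝ) {S : Finset (Fin K)} (hS : S ≠ Finset.univ) (y : Fin K)
    (θ : Simplex K) : marginal ε κ S y θ ≤ 1 := by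
  rw [← marginal_sum ε κ hS θ]
  exact Finset.single_le_sum (f := fun y => marginal ε κ S y θ)
    (fun z _ => (marginal_pos ε κ hS z θ).le) (Finset.mem_univ y)

lemma measurable_simplex_apply {K : ℕ} (x : Fin K) : Measurable fun θ : Simplex K => θ x :=
  (measurable_pi_apply x).comp measurable_subtype_coe

lemma measurable_marginal {K : ℕ} (ε κ : ℝ) (S : Finset (Fin K)) (y : Fin K) :
    Measurable (marginal ε κ S y) :=
  Finset.measurable_sum _ fun x _ => (measurable_simplex_apply x).const_mul _

lemma isProbabilityMeasure_posterior {K : ℕ} (ε κ : ℝ) (η : Prior K) {ι : Type} [Fintype ι]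
    (s : ι → Finset (Fin K)) (hs : ∀ i, s i ≠ Finset.univ) (y : ι → Fin K) :
    IsProbabilityMeasure (posterior ε κ η s y) := by
  have hprod_pos : ∀ θ, 0 < ∏ i, marginal ε κ (s i) (y i) θ := fun θ =>
    Finset.prod_pos fun i _ => marginal_pos ε κ (hs i) _ _
  have hprod_le : ∀ θ, ∏ i, marginal ε κ (s i) (y i) θ ≤ 1 := fun θ =>
    Finset.prod_le_one (fun i _ => (marginal_pos ε κ (hs i) _ _).le)
      fun i _ => marginal_le_one ε κ (hs i) _ _
  have hmeas : Measurable fun θ =>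
      ENNReal.ofReal (η.density θ * ∏ i, marginal ε κ (s i) (y i) θ) :=
    (η.measurable_density.mul
      (Finset.measurable_prod _ fun i _ => measurable_marginal _ _ _ _)).ennreal_ofReal
  have hZ : posteriorWeight ε κ η s y Set.univ = ∫⁻ θ, ENNReal.ofReal
      (η.density θ * ∏ i, marginal ε κ (s i) (y i) θ) ∂(simplexVolume K) := by
    rw [posteriorWeight, withDensity_apply _ MeasurableSet.univ, Measure.restrict_univ]
  have htop : posteriorWeight ε κ η s y Set.univ ≠ ⊤ := by
    rw [hZ]
    refine ne_top_of_le_ne_top ENNReal.one_ne_top ?_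
    rw [← η.lintegral_density]
    refine lintegral_mono fun θ => ENNReal.ofReal_le_ofReal ?_
    exact mul_le_of_le_one_right (η.density_nonneg θ) (hprod_le θ)
  have hzero : posteriorWeight ε κ η s y Set.univ ≠ 0 := by
    rw [hZ]
    intro h
    rw [lintegral_eq_zero_iff hmeas] at h
    have h0 : ∫⁻ θ, ENNReal.ofReal (η.density θ) ∂(simplexVolume K) = 0 := by
      rw [lintegral_eq_zero_iff η.measurable_density.ennreal_ofReal]
      filter_upwards [h] with θ hθ
      simp only [Pi.zero_apply, ENNReal.ofReal_eq_zero] at hθ ⊢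
      by_contra! hlt
      exact absurd (mul_pos hlt (hprod_pos θ)) (not_lt.mpr hθ)
    rw [η.lintegral_density] at h0
    exact one_ne_zero h0
  constructor
  rw [posterior, Measure.smul_apply, smul_eq_mul, ENNReal.inv_mul_cancel hzero htop]

/-! ### The law of the algorithm -/

/-- The law of the response obtained with the subset `S` in a population with parameter `θ`. -/
def responseLaw {K : ℕ} (ε κ : ℝ) (θ : Simplex K) (S : Finset (Fin K)) : Measure (Fin K) :=
  ∑ y, ENNReal.ofReal (marginal ε κ S y θ) • Measure.dirac y

lemma isProbabilityMeasure_responseLaw {K : ℕ} (ε κ : ℝ) (θ : Simplex K) {S : Finset (Fin K)}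
    (hS : S ≠ Finset.univ) : IsProbabilityMeasure (responseLaw ε κ θ S) := by
  constructor
  simp only [responseLaw, Measure.coe_finsetSum, Finset.sum_apply, Measure.smul_apply,
    measure_univ, smul_eq_mul, mul_one]
  rw [← ENNReal.ofReal_sum_of_nonneg fun y _ => (marginal_pos ε κ hS y θ).le,
    marginal_sum ε κ hS, ENNReal.ofReal_one]

section Law

variable {K : ℕ} {U : Simplex K → Finset (Fin K) → ℝ → ℝ} {ε : ℝ}

lemma SelectionRule.best_ne_univ (R : SelectionRule U ε) (θ : Simplex K) :
    R.best θ ≠ Finset.univ := topSet_ne_univ _ _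

/-- One round of the algorithm as a state: the parameter `Θ_n` on which the selection of `S_{n+1}`
is based, together with the response `Y_{n+1}` obtained with that subset. -/
abbrev State (K : ℕ) : Type := Simplex K × Fin K

/-- The subsets used and the responses collected in a finite history. -/
def record (R : SelectionRule U ε) {n : ℕ} (w : Finset.Iic n → State K) :
    Finset.Iic n → Finset (Fin K) × Fin K :=
  fun i => (R.best (w i).1, (w i).2)

lemma measurable_record (R : SelectionRule U ε) (n : ℕ) :
    Measurable (record R : (Finset.Iic n → State K) → _) :=
  measurable_pi_lambda _ fun i =>
    ((R.measurable_topSet.comp measurable_fst).prodMk measurable_snd).comp (measurable_pi_apply i)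

/-- Exact posterior sampling: given the history, the next parameter is drawn from the posterior
distribution given the subsets used and the responses collected so far. -/
def samplingKernel (κ : ℝ) (η : Prior K) (R : SelectionRule U ε) (n : ℕ) :
    Kernel (Finset.Iic n → State K) (Simplex K) :=
  (Kernel.ofFunOfCountable fun r : Finset.Iic n → Finset (Fin K) × Fin K =>
    posterior ε κ η (fun i => (r i).1) (fun i => (r i).2)).comap (record R) (measurable_record R n)

instance (κ : ℝ) (η : Prior K) (R : SelectionRule U ε) (n : ℕ) :
    IsMarkovKernel (samplingKernel κ η R n) :=
  ⟨fun w => isProbabilityMeasure_posterior ε κ η (fun i => R.best (w i).1)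
    (fun _ => R.best_ne_univ _) (fun i => (w i).2)⟩

/-- Response generation: given the current parameter `ϑ`, the subset `S*_ϑ` is used on an individual
from the population with parameter `θ`. -/
def responseKernel (κ : ℝ) (R : SelectionRule U ε) (θ : Simplex K) : Kernel (Simplex K) (Fin K) :=
  (Kernel.ofFunOfCountable (responseLaw ε κ θ)).comap R.best R.measurable_topSet

instance (κ : ℝ) (R : SelectionRule U ε) (θ : Simplex K) :
    IsMarkovKernel (responseKernel κ R θ) :=
  ⟨fun ϑ => isProbabilityMeasure_responseLaw ε κ θ (R.best_ne_univ ϑ)⟩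

/-- One step of the algorithm in a population with parameter `θ`. -/
def stepKernel (κ : ℝ) (η : Prior K) (R : SelectionRule U ε) (θ : Simplex K) (n : ℕ) :
    Kernel (Finset.Iic n → State K) (State K) :=
  samplingKernel κ η R n ⊗ₖ Kernel.prodMkLeft (Finset.Iic n → State K) (responseKernel κ R θ)

instance (κ : ℝ) (η : Prior K) (R : SelectionRule U ε) (θ : Simplex K) (n : ℕ) :
    IsMarkovKernel (stepKernel κ η R θ n) := by
  unfold stepKernel; infer_instance

/-- The law `P_θ` of the whole run `((Θ_n, Y_{n+1}))_{n ≥ 0}` of the algorithm with exact posterior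
sampling in a population with parameter `θ`, started from `Θ_0 = θinit`. -/
def runLaw (κ : ℝ) (η : Prior K) (R : SelectionRule U ε) (θ θinit : Simplex K) :
    Measure (ℕ → State K) :=
  Kernel.trajMeasure (X := fun _ => State K)
    ((Measure.dirac θinit) ⊗ₘ (responseKernel κ R θ)) (stepKernel κ η R θ)

/-- The subset `S_t`, `t ≥ 1`, selected at time `t` from `Θ_{t-1}`. -/
def selected (R : SelectionRule U ε) (t : ℕ) (w : ℕ → State K) : Finset (Fin K) :=
  R.best (w (t - 1)).1

end Law

/-- The prior density is positive near `θ₀` and its ratios to the values there are bounded. -/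
def PriorCondition {K : ℕ} (η : Prior K) (θ₀ : Simplex K) : Prop :=
  ∃ d B : ℝ, 0 < d ∧ 0 < B ∧ ∀ θ θ' : Simplex K,
    ‖WithLp.toLp 2 ((θ' : Fin K → ℝ) - (θ₀ : Fin K → ℝ))‖ < d →
      0 < η.density θ' ∧ η.density θ / η.density θ' < B

end AdOBEst

end

open MeasureTheory ProbabilityTheory Filter Topology
open scoped ENNReal

noncomputable section

namespace AdOBEst

/-! ### Identifiability of the mechanism -/

/-! The proof is a posterior consistency argument by Hellinger affinities, made uniform over the
subsets, so that the adaptive choice of `S_t` does no harm. For every proper subset the response law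
determines `θ` (`marginal_injective`), so for `θ₁ ≠ θ*` the affinity `∑ y, √(h(y|θ*) h(y|θ₁))` is
below one. There are finitely many subsets, hence a common bound `r < 1` (`exists_affinity_le`).

Choose `c > 1` with `c * r < 1`. Near `θ₁` each single likelihood is at most `c` times its value at
`θ₁`; near `θ*` it is at least `1/c` times its value at `θ*`. The prior mass `m` of the second
neighbourhood is positive, so the posterior mass of the first is at most `m⁻¹` times a product of
ratios `c² h(y|θ₁) / h(y|θ*)` (`posterior_le`). A probability is at most its square root, and after
the square root each factor has conditional mean at most `c * r`, whatever the past
(`lintegral_prod_runLaw_le`). The probability of sampling near `θ₁` thus decays geometrically.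

Compactness of the simplex extends this to the complement of any neighbourhood of `θ*`
(`tendsto_runLaw_mem_nhds`). Near `θ*` the ranking and the optimal size do not change
(`SelectionRule.eventually_best_eq`), so the selected subset is the right one; Cesàro averaging
gives the frequency claim. -/

/-- The common value of the off-diagonal randomized response probabilities on `n` categories. -/
def srrOff (n : ℕ) (e : ℝ) : ℝ :=
  (1 - Real.exp e / (Real.exp e + (n : ℝ) - 1)) * (1 / ((n : ℝ) - 1))

/-- The excess of the diagonal over the off-diagonal randomized response probabilities. -/
def srrGap (n : ℕ) (e : ℝ) : ℝ :=
  Real.exp e / (Real.exp e + (n : ℝ) - 1) - srrOff n e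

/-- As a matrix on `Ω`, randomized response is a constant plus a multiple of the identity. Applied
to a vector of total mass zero, it therefore only rescales coordinates. -/
lemma srr_eq_off_add {K : ℕ} {Ω : Finset (Fin K)} {y : Fin K} (hy : y ∈ Ω) (e : ℝ) (x : Fin K) :
    srr Ω e x y = srrOff Ω.card e + if y = x then srrGap Ω.card e else 0 := by
  by_cases h : y = x <;> simp [srr, srrGap, srrOff, h]
  intro hy'
  exact absurd hy hy'

lemma srrGap_pos {n : ℕ} (hn : 0 < n) {e : ℝ} (he : 0 < e) : 0 < srrGap n e := by
  have h1 : 1 < Real.exp e := Real.one_lt_exp_iff.mpr he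
  have hn1 : (1 : ℝ) ≤ n := by exact_mod_cast hn
  have hD : 0 < Real.exp e + (n : ℝ) - 1 := by linarith
  unfold srrGap srrOff
  rcases eq_or_lt_of_le hn1 with h | h
  -- With a single category `1 / 0 = 0` makes the off-diagonal value vanish, and the gap is one.
  · rw [← h]; simp
  · have h2 : (0 : ℝ) < n - 1 := by linarith
    have : Real.exp e / (Real.exp e + (n : ℝ) - 1)
        - (1 - Real.exp e / (Real.exp e + (n : ℝ) - 1)) * (1 / ((n : ℝ) - 1))
        = (Real.exp e - 1) / (Real.exp e + (n : ℝ) - 1) := by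
      field_simp
      ring
    rw [this]
    exact div_pos (by linarith) hD

lemma eps2_pos {K : ℕ} {ε ε₁ : ℝ} (hε : 0 < ε) (h : ε₁ < ε) (S : Finset (Fin K)) :
    0 < eps2 ε ε₁ S := by
  unfold eps2
  split_ifs with hc
  · refine lt_min hε (Real.log_pos ?_)
    obtain ⟨hlog, -⟩ := hc
    set m : ℝ := (Sᶜ.card : ℝ)
    have hm0 : 0 < m := by
      -- An empty complement is excluded by the convention `log 0 = 0`, which would force `ε < ε₁`.
      rcases (Nat.cast_nonneg (α := ℝ) Sᶜ.card).eq_or_lt with h0 | h0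
      · have : m = 0 := h0.symm
        rw [this, Real.log_zero] at hlog
        linarith
      · exact h0
    have hexp : Real.exp (ε - ε₁) < m := (Real.lt_log_iff_exp_lt hm0).mp hlog
    have hden : 0 < Real.exp (ε₁ - ε) * m - 1 := by
      have : Real.exp (ε₁ - ε) * Real.exp (ε - ε₁) = 1 := by
        rw [← Real.exp_add]; simp
      nlinarith [Real.exp_pos (ε₁ - ε)]
    -- With a positive denominator the quotient exceeds one exactly when `exp (ε₁ - ε) * m < m`.
    rw [one_lt_div hden]
    have : Real.exp (ε₁ - ε) < 1 := Real.exp_lt_one_iff.mpr (by linarith)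
    nlinarith
  · exact hε

/-- The set `insert r S` has the same size for every `r ∈ Sᶜ`, and a drawn `r` never equals `y ∈ S`.
The randomness of `r` thus averages out. -/
lemma rrrr_of_mem {K : ℕ} (ε κ : ℝ) {S : Finset (Fin K)} (hS : S ≠ Finset.univ) {y : Fin K}
    (hy : y ∈ S) (x : Fin K) :
    rrrr ε κ S y x = srrOff (S.card + 1) (κ * ε)
      + if y = x then srrGap (S.card + 1) (κ * ε) else 0 := by
  have hc : (Sᶜ.card : ℝ) ≠ 0 := by exact_mod_cast (compl_nonempty hS).card_pos.ne'
  have hcard : ∀ r ∈ Sᶜ, (insert r S).card = S.card + 1 := fun r hr =>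
    Finset.card_insert_of_notMem (Finset.mem_compl.mp hr)
  unfold rrrr
  split_ifs with hx hyx hyx
  · rw [Finset.sum_congr rfl fun r hr => by
      rw [srr_eq_off_add (Finset.mem_insert_of_mem hy), hcard r hr, if_pos hyx]]
    rw [Finset.sum_const, nsmul_eq_mul]
    field_simp
  · rw [Finset.sum_congr rfl fun r hr => by
      rw [srr_eq_off_add (Finset.mem_insert_of_mem hy), hcard r hr, if_neg hyx]]
    rw [Finset.sum_const, nsmul_eq_mul]
    field_simp
  · exact absurd (hyx ▸ hy) hx
  · rw [Finset.sum_congr rfl fun r hr => by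
      rw [srr_eq_off_add (Finset.mem_insert_of_mem hy), hcard r hr,
        if_neg (fun h : y = r => Finset.mem_compl.mp hr (h ▸ hy))]]
    rw [← Finset.sum_mul, srr_sum (Finset.mem_compl.mpr hx), one_mul, add_zero]

/-- An output outside `S` can only be the drawn element itself, so one term of the sum survives. -/
lemma rrrr_of_notMem {K : ℕ} (ε κ : ℝ) {S : Finset (Fin K)} {x y : Fin K} (hy : y ∉ S)
    (hx : x ∉ S) :
    rrrr ε κ S y x = srr Sᶜ (eps2 ε (κ * ε) S) x y * srr (insert y S) (κ * ε) y y := by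
  unfold rrrr
  rw [if_neg hx]
  refine Finset.sum_eq_single_of_mem y (Finset.mem_compl.mpr hy) fun r hr hry => ?_
  rw [srr_eq_zero (Finset.mem_insert_self r S) (y := y), mul_zero]
  simp [hry.symm, hy]

/-- The law of the response determines the law of the input. -/
lemma marginal_injective {K : ℕ} {ε κ : ℝ} (hε : 0 < ε) (hκ₀ : 0 < κ) (hκ₁ : κ < 1)
    {S : Finset (Fin K)} (hS : S ≠ Finset.univ) :
    Function.Injective fun (θ : Simplex K) (y : Fin K) => marginal ε κ S y θ := by
  intro θ θ' h
  set δ : Fin K → ℝ := fun x => θ x - θ' x with hδ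
  have hzero : ∀ y, ∑ x, rrrr ε κ S y x * δ x = 0 := by
    intro y
    simp_rw [hδ, mul_sub, Finset.sum_sub_distrib]
    exact sub_eq_zero.mpr (congrFun h y)
  have hsum : ∑ x, δ x = 0 := by
    simp_rw [hδ, Finset.sum_sub_distrib, simplex_sum, sub_self]
  -- The constant part of row `y` is killed by `∑ δ = 0`; what remains is the gap times `δ y`.
  have hin : ∀ y ∈ S, δ y = 0 := by
    intro y hy
    have := hzero y
    simp_rw [rrrr_of_mem ε κ hS hy, add_mul, Finset.sum_add_distrib, ← Finset.mul_sum, hsum,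
      ite_mul, zero_mul, Finset.sum_ite_eq, Finset.mem_univ, if_true, mul_zero, zero_add] at this
    exact (mul_eq_zero.mp this).resolve_left (srrGap_pos (Nat.succ_pos _) (mul_pos hκ₀ hε)).ne'
  have hcompl : ∀ f : Fin K → ℝ, ∑ x, f x * δ x = ∑ x ∈ Sᶜ, f x * δ x := fun f =>
    (Finset.sum_subset (Finset.subset_univ _) fun x _ hx => by
      rw [hin x (by simpa using hx), mul_zero]).symm
  -- Since `δ` vanishes on `S`, its sum over `Sᶜ` is zero too. The second randomization contributes
  -- only a positive factor, so the same argument applies to the randomized response on `Sᶜ`.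
  have hout : ∀ y ∉ S, δ y = 0 := by
    intro y hy
    have hyc := Finset.mem_compl.mpr hy
    have h1 := hzero y
    rw [hcompl, Finset.sum_congr rfl fun x hx => by
      rw [rrrr_of_notMem ε κ hy (Finset.mem_compl.mp hx), mul_right_comm],
      ← Finset.sum_mul] at h1
    have h2 := (mul_eq_zero.mp h1).resolve_right
      (srr_pos (Finset.mem_insert_self y S) (Finset.mem_insert_self y S) _).ne'
    have h3 : ∑ x ∈ Sᶜ, δ x = 0 := by
      have := hcompl fun _ => 1
      simp only [one_mul] at this
      rw [← this, hsum]
    simp_rw [srr_eq_off_add hyc, add_mul, Finset.sum_add_distrib, ← Finset.mul_sum, h3,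
      ite_mul, zero_mul, Finset.sum_ite_eq, if_pos hyc, mul_zero, zero_add] at h2
    exact (mul_eq_zero.mp h2).resolve_left (srrGap_pos (Finset.card_pos.mpr ⟨y, hyc⟩)
      (eps2_pos hε (by nlinarith) S)).ne'
  ext y
  by_cases hy : y ∈ S
  · exact sub_eq_zero.mp (hin y hy)
  · exact sub_eq_zero.mp (hout y hy)

/-! ### Hellinger affinity -/

lemma sqrt_mul_le_half {a b : ℝ} (ha : 0 ≤ a) (hb : 0 ≤ b) : √(a * b) ≤ (a + b) / 2 := by
  refine Real.sqrt_le_iff.mpr ⟨by positivity, ?_⟩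
  nlinarith [sq_nonneg (a - b)]

lemma sqrt_mul_lt_half {a b : ℝ} (ha : 0 ≤ a) (hb : 0 ≤ b) (hab : a ≠ b) :
    √(a * b) < (a + b) / 2 := by
  have := sq_pos_of_ne_zero (sub_ne_zero.mpr hab)
  exact (Real.sqrt_lt' (by rcases ha.eq_or_lt with h | h <;> grind)).mpr (by nlinarith)

/-- The Hellinger affinities between the responses under two distinct parameters are bounded away
from one, uniformly in the subset. -/
lemma exists_affinity_le {K : ℕ} {ε κ : ℝ} (hε : 0 < ε) (hκ₀ : 0 < κ) (hκ₁ : κ < 1)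
    {θ θ' : Simplex K} (hne : θ ≠ θ') :
    ∃ r : ℝ, r < 1 ∧ ∀ S : Finset (Fin K), S ≠ Finset.univ →
      ∑ y, √(marginal ε κ S y θ * marginal ε κ S y θ') ≤ r := by
  have hlt : ∀ S : Finset (Fin K), S ≠ Finset.univ →
      ∑ y, √(marginal ε κ S y θ * marginal ε κ S y θ') < 1 := by
    intro S hS
    obtain ⟨y, hy⟩ := Function.ne_iff.mp ((marginal_injective hε hκ₀ hκ₁ hS).ne hne)
    calc ∑ y, √(marginal ε κ S y θ * marginal ε κ S y θ')
        < ∑ y, (marginal ε κ S y θ + marginal ε κ S y θ') / 2 :=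
          Finset.sum_lt_sum
            (fun z _ => sqrt_mul_le_half (marginal_pos ε κ hS z θ).le (marginal_pos ε κ hS z θ').le)
            ⟨y, Finset.mem_univ _, sqrt_mul_lt_half (marginal_pos ε κ hS y θ).le
              (marginal_pos ε κ hS y θ').le hy⟩
      _ = 1 := by
          rw [← Finset.sum_div, Finset.sum_add_distrib, marginal_sum ε κ hS, marginal_sum ε κ hS]
          norm_num
  -- Finitely many strict bounds hold simultaneously for all `r` close enough to one from the left.
  have hev : ∀ᶠ r : ℝ in 𝓝[<] 1, ∀ S : Finset (Fin K), S ≠ Finset.univ →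
      ∑ y, √(marginal ε κ S y θ * marginal ε κ S y θ') ≤ r := by
    rw [eventually_all]
    intro S
    by_cases hS : S = Finset.univ
    · simp [hS]
    · filter_upwards [nhdsWithin_le_nhds (lt_mem_nhds (hlt S hS))] with r hr _ using hr.le
  obtain ⟨r, hr, hr1⟩ := (hev.and eventually_mem_nhdsWithin).exists
  exact ⟨r, hr1, hr⟩

/-! ### Mass of neighbourhoods of a parameter -/

lemma continuous_simplex_apply {K : ℕ} (x : Fin K) : Continuous fun θ : Simplex K => θ x :=
  (continuous_apply x).comp continuous_subtype_val

lemma continuous_marginal {K : ℕ} (ε κ : ℝ) (S : Finset (Fin K)) (y : Fin K) :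
    Continuous (marginal ε κ S y) :=
  continuous_finsetSum _ fun x _ => (continuous_simplex_apply x).const_mul _

lemma continuous_freeCoords {K : ℕ} : Continuous (freeCoords : Simplex K → _) :=
  continuous_pi fun _ => continuous_simplex_apply _

lemma freeCoords_injective {K : ℕ} : Function.Injective (freeCoords : Simplex K → _) := by
  intro θ θ' h
  obtain _ | n := K
  · exact Subtype.ext (funext fun i => i.elim0)
  · have hc : ∀ i : Fin n, θ i.castSucc = θ' i.castSucc := fun i => congrFun h i
    have h1 := simplex_sum θ
    have h2 := simplex_sum θ'
    rw [Fin.sum_univ_castSucc] at h1 h2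
    simp_rw [hc] at h1
    ext i
    refine Fin.lastCases ?_ (fun j => hc j) i
    change θ (Fin.last n) = θ' (Fin.last n)
    linarith

lemma measurableEmbedding_freeCoords {K : ℕ} : MeasurableEmbedding (freeCoords : Simplex K → _) :=
  (continuous_freeCoords.isClosedEmbedding freeCoords_injective).measurableEmbedding

lemma simplexVolume_apply {K : ℕ} (A : Set (Simplex K)) :
    simplexVolume K A = volume (freeCoords '' A) :=
  measurableEmbedding_freeCoords.comap_apply _ A

/-- Positivity is read off from the existence of a normalized density, which avoids computing the
volume of the simplex. -/
lemma Prior.simplexVolume_univ_pos {K : ℕ} (η : Prior K) : 0 < simplexVolume K Set.univ := by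
  rw [pos_iff_ne_zero]
  intro h
  have := η.lintegral_density
  rw [Measure.measure_univ_eq_zero.mp h, lintegral_zero_measure] at this
  exact zero_ne_one this

/-- The point of the simplex that divides the segment from `θ₀` to `θ` in the ratio `t : 1 - t`. -/
def contract {K : ℕ} (θ₀ : Simplex K) (t : Set.Icc (0 : ℝ) 1) (θ : Simplex K) : Simplex K :=
  ⟨fun x => (1 - t) * θ₀ x + t * θ x,
    fun x => add_nonneg (mul_nonneg (by linarith [t.2.2]) (simplex_nonneg θ₀ x))
      (mul_nonneg t.2.1 (simplex_nonneg θ x)), by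
    rw [Finset.sum_add_distrib, ← Finset.mul_sum, ← Finset.mul_sum, simplex_sum, simplex_sum]
    ring⟩

lemma freeCoords_contract {K : ℕ} (θ₀ : Simplex K) (t : Set.Icc (0 : ℝ) 1) (θ : Simplex K) :
    freeCoords (contract θ₀ t θ) = AffineMap.homothety (freeCoords θ₀) (t : ℝ) (freeCoords θ) := by
  funext i
  simp only [freeCoords, AffineMap.homothety_apply, vsub_eq_sub, vadd_eq_add, smul_eq_mul,
    Pi.add_apply, Pi.smul_apply, Pi.sub_apply]
  change (1 - (t : ℝ)) * _ + t * _ = _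
  ring

lemma exists_contract_mem {K : ℕ} {θ₀ : Simplex K} {W : Set (Simplex K)} (hW : W ∈ 𝓝 θ₀) :
    ∃ t : Set.Icc (0 : ℝ) 1, 0 < (t : ℝ) ∧ ∀ θ, contract θ₀ t θ ∈ W := by
  have hcont : Continuous fun p : Set.Icc (0 : ℝ) 1 × Simplex K => contract θ₀ p.1 p.2 := by
    refine Continuous.subtype_mk (continuous_pi fun x => ?_) _
    have := (continuous_simplex_apply x).comp
      (continuous_snd (X := Set.Icc (0 : ℝ) 1) (Y := Simplex K))
    have h2 : Continuous fun p : Set.Icc (0 : ℝ) 1 × Simplex K => (p.1 : ℝ) := by fun_prop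
    exact ((continuous_const.sub h2).mul continuous_const).add (h2.mul this)
  have h0 : ∀ θ, contract θ₀ 0 θ = θ₀ := fun θ => by
    apply Subtype.ext
    funext x
    change (1 - (0 : ℝ)) * _ + 0 * _ = θ₀ x
    ring
  have hev : ∀ᶠ t : Set.Icc (0 : ℝ) 1 in 𝓝 0, ∀ θ ∈ (Set.univ : Set (Simplex K)),
      contract θ₀ t θ ∈ W := by
    -- The ratio `t = 0` collapses the simplex to `θ₀`; by compactness a small `t` works for all `θ`
    -- at once.
    refine isCompact_univ.eventually_forall_of_forall_eventually fun θ _ => ?_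
    refine hcont.continuousAt.eventually_mem ?_
    simpa [h0] using hW
  obtain ⟨a, ha, hmem⟩ := Metric.eventually_nhds_iff.mp hev
  refine ⟨⟨min (a / 2) 1, by positivity, min_le_right _ _⟩, by positivity, fun θ =>
    hmem ?_ θ (Set.mem_univ _)⟩
  rw [Subtype.dist_eq, Real.dist_eq]
  change |min (a / 2) 1 - 0| < a
  rw [sub_zero, abs_of_pos (by positivity)]
  exact (min_le_left _ _).trans_lt (by linarith)

/-- A neighbourhood of `θ₀` contains a homothetic copy of the whole simplex centred at `θ₀`, whose
volume is scaled by a positive factor. This covers `θ₀` on the boundary as well. -/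
lemma simplexVolume_pos_of_mem_nhds {K : ℕ} (hK : 0 < simplexVolume K Set.univ) {θ₀ : Simplex K}
    {W : Set (Simplex K)} (hW : W ∈ 𝓝 θ₀) : 0 < simplexVolume K W := by
  obtain ⟨t, ht, hmem⟩ := exists_contract_mem hW
  have hsub : AffineMap.homothety (freeCoords θ₀) (t : ℝ) '' (freeCoords '' Set.univ)
      ⊆ freeCoords '' W := by
    rintro _ ⟨_, ⟨θ, -, rfl⟩, rfl⟩
    exact ⟨contract θ₀ t θ, hmem θ, freeCoords_contract θ₀ t θ⟩
  rw [simplexVolume_apply] at hK ⊢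
  refine lt_of_lt_of_le ?_ (measure_mono hsub)
  rw [Measure.addHaar_image_homothety]
  exact ENNReal.mul_pos (ENNReal.ofReal_pos.mpr (by positivity)).ne' hK.ne'

lemma PriorCondition.eventually_density_pos {K : ℕ} {η : Prior K} {θ₀ : Simplex K}
    (h : PriorCondition η θ₀) : ∀ᶠ θ in 𝓝 θ₀, 0 < η.density θ := by
  obtain ⟨d, B, hd, -, hdB⟩ := h
  have hcont : Continuous fun θ : Simplex K =>
      ‖WithLp.toLp 2 ((θ : Fin K → ℝ) - (θ₀ : Fin K → ℝ))‖ :=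
    ((PiLp.continuous_toLp 2 _).comp (continuous_subtype_val.sub continuous_const)).norm
  have : ∀ᶠ θ : Simplex K in 𝓝 θ₀, ‖WithLp.toLp 2 ((θ : Fin K → ℝ) - (θ₀ : Fin K → ℝ))‖ < d :=
    hcont.continuousAt.eventually_lt continuousAt_const (by simpa using hd)
  filter_upwards [this] with θ hθ
  exact (hdB θ θ hθ).1

lemma PriorCondition.setLIntegral_density_pos {K : ℕ} {η : Prior K} {θ₀ : Simplex K}
    (h : PriorCondition η θ₀) {W : Set (Simplex K)} (hW : W ∈ 𝓝 θ₀) :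
    0 < ∫⁻ θ in W, ENNReal.ofReal (η.density θ) ∂(simplexVolume K) := by
  rw [setLIntegral_pos_iff η.measurable_density.ennreal_ofReal]
  refine simplexVolume_pos_of_mem_nhds η.simplexVolume_univ_pos (inter_mem ?_ hW)
  filter_upwards [h.eventually_density_pos] with θ hθ
  simpa using hθ

/-! ### Stability of the selected subset -/

/-- Strict ordering makes `f` injective, so both arrangements are strictly monotone with the same
range, hence equal. -/
lemma perm_eq_of_antitone_of_strictAnti {K : ℕ} {f : Fin K → ℝ} {σ τ : Equiv.Perm (Fin K)}
    (hσ : Antitone fun i => f (σ i)) (hτ : StrictAnti fun i => f (τ i)) : σ = τ := by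
  have hf : Function.Injective f := fun a b hab => by
    have := hτ.injective (a₁ := τ.symm a) (a₂ := τ.symm b) (by simpa using hab)
    exact τ.symm.injective this
  have hσ' : StrictAnti fun i => f (σ i) :=
    hσ.strictAnti_of_injective (hf.comp σ.injective)
  have hrange : ∀ ρ : Equiv.Perm (Fin K), Set.range (fun i => -f (ρ i)) = Set.range fun i => -f i :=
    fun ρ => ρ.surjective.range_comp fun i => -f i
  have := (StrictMono.range_inj hσ'.neg hτ.neg).mp ((hrange σ).trans (hrange τ).symm)
  exact Equiv.ext fun i => hf (neg_injective (congrFun this i))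

/-- Near a parameter with distinct components and a unique optimal size, the selected subset is
constant. -/
lemma SelectionRule.eventually_best_eq {K : ℕ} {U : Simplex K → Finset (Fin K) → ℝ → ℝ} {ε : ℝ}
    (R : SelectionRule U ε) {θ₀ : Simplex K} (horder : StrictAnti fun i => θ₀ (R.σ θ₀ i))
    (hcont : ∀ S : Finset (Fin K), S ≠ Finset.univ → Continuous fun θ => U θ S ε)
    (hunique : ∃! k : Fin K, ∀ j : Fin K,
      U θ₀ (topSet (R.σ θ₀) j) ε ≤ U θ₀ (topSet (R.σ θ₀) k) ε) :
    ∀ᶠ θ in 𝓝 θ₀, R.best θ = R.best θ₀ := by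
  have hlt : ∀ j, j ≠ R.k θ₀ →
      U θ₀ (topSet (R.σ θ₀) j) ε < U θ₀ (topSet (R.σ θ₀) (R.k θ₀)) ε := by
    intro j hj
    by_contra! hle
    exact hj (hunique.unique (fun i => (R.maximal θ₀ i).trans hle) (R.maximal θ₀))
  have h1 : ∀ᶠ θ in 𝓝 θ₀, ∀ i j : Fin K, i < j → θ (R.σ θ₀ j) < θ (R.σ θ₀ i) := by
    simp_rw [eventually_all]
    intro i j hij
    have hc : ∀ x : Fin K, Continuous fun θ : Simplex K => θ x := fun x =>
      (continuous_apply x).comp continuous_subtype_val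
    exact (hc _).continuousAt.eventually_lt (hc _).continuousAt (horder hij)
  have h2 : ∀ᶠ θ in 𝓝 θ₀, ∀ j, j ≠ R.k θ₀ →
      U θ (topSet (R.σ θ₀) j) ε < U θ (topSet (R.σ θ₀) (R.k θ₀)) ε := by
    simp_rw [eventually_all]
    intro j hj
    exact (hcont _ (topSet_ne_univ _ _)).continuousAt.eventually_lt
      (hcont _ (topSet_ne_univ _ _)).continuousAt (hlt j hj)
  filter_upwards [h1, h2] with θ hθ1 hθ2
  have hσ : R.σ θ = R.σ θ₀ := perm_eq_of_antitone_of_strictAnti (R.sorted θ) fun i j => hθ1 i j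
  have hk : R.k θ = R.k θ₀ := by
    by_contra hne
    have := R.maximal θ (R.k θ₀)
    rw [hσ] at this
    exact absurd (hθ2 _ hne) (not_lt.mpr this)
  rw [SelectionRule.best, SelectionRule.best, hσ, hk]

/-! ### Posterior concentration -/

/-- Where the likelihood of a single response exceeds that of `θ₁` by a factor at most `c`, and with
`W` a set where it falls short of that of `θ₀` by a factor at most `c`, the posterior is bounded by
the likelihood ratio of `θ₁` and `θ₀`. -/
lemma posterior_le {K : ℕ} {ε κ : ℝ} (η : Prior K) {θ₀ θ₁ : Simplex K} {c : ℝ} (hc : 0 < c)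
    {V W : Set (Simplex K)} (hVm : MeasurableSet V) (hWm : MeasurableSet W)
    (hV : ∀ θ ∈ V, ∀ S ≠ Finset.univ, ∀ y, marginal ε κ S y θ ≤ c * marginal ε κ S y θ₁)
    (hW : ∀ θ ∈ W, ∀ S ≠ Finset.univ, ∀ y, marginal ε κ S y θ₀ ≤ c * marginal ε κ S y θ)
    {ι : Type} [Fintype ι] (s : ι → Finset (Fin K)) (hs : ∀ i, s i ≠ Finset.univ)
    (y : ι → Fin K) :
    posterior ε κ η s y V ≤ (∫⁻ θ in W, ENNReal.ofReal (η.density θ) ∂(simplexVolume K))⁻¹ *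
      ENNReal.ofReal
        (∏ i, c ^ 2 * (marginal ε κ (s i) (y i) θ₁ / marginal ε κ (s i) (y i) θ₀)) := by
  set m := ∫⁻ θ in W, ENNReal.ofReal (η.density θ) ∂(simplexVolume K)
  set a : ℝ := ∏ i, c * marginal ε κ (s i) (y i) θ₁ with ha
  set b : ℝ := ∏ i, marginal ε κ (s i) (y i) θ₀ / c with hb
  have hpos : ∀ i θ, 0 < marginal ε κ (s i) (y i) θ := fun i θ => marginal_pos ε κ (hs i) _ _
  have ha0 : 0 ≤ a := Finset.prod_nonneg fun i _ => (mul_pos hc (hpos i θ₁)).le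
  have hb0 : 0 < b := Finset.prod_pos fun i _ => div_pos (hpos i θ₀) hc
  have hupper : posteriorWeight ε κ η s y V ≤ ENNReal.ofReal a := by
    rw [posteriorWeight, withDensity_apply _ hVm]
    calc ∫⁻ θ in V, ENNReal.ofReal (η.density θ * ∏ i, marginal ε κ (s i) (y i) θ)
          ∂(simplexVolume K)
        ≤ ∫⁻ θ in V, ENNReal.ofReal a * ENNReal.ofReal (η.density θ) ∂(simplexVolume K) := by
          refine setLIntegral_mono' hVm fun θ hθ => ?_
          rw [← ENNReal.ofReal_mul ha0, mul_comm a]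
          refine ENNReal.ofReal_le_ofReal (mul_le_mul_of_nonneg_left ?_ (η.density_nonneg θ))
          exact Finset.prod_le_prod (fun i _ => (hpos i θ).le) fun i _ => hV θ hθ _ (hs i) _
      _ = ENNReal.ofReal a * ∫⁻ θ in V, ENNReal.ofReal (η.density θ) ∂(simplexVolume K) :=
          lintegral_const_mul _ η.measurable_density.ennreal_ofReal
      -- The prior mass of `V` is at most one.
      _ ≤ ENNReal.ofReal a * 1 := by
          gcongr
          rw [← η.lintegral_density]
          exact setLIntegral_le_lintegral _ _
      _ = ENNReal.ofReal a := mul_one _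
  have hlower : ENNReal.ofReal b * m ≤ posteriorWeight ε κ η s y Set.univ := by
    calc ENNReal.ofReal b * m
        = ∫⁻ θ in W, ENNReal.ofReal b * ENNReal.ofReal (η.density θ) ∂(simplexVolume K) :=
          (lintegral_const_mul _ η.measurable_density.ennreal_ofReal).symm
      _ ≤ ∫⁻ θ in W, ENNReal.ofReal (η.density θ * ∏ i, marginal ε κ (s i) (y i) θ)
          ∂(simplexVolume K) := by
          refine setLIntegral_mono' hWm fun θ hθ => ?_
          rw [← ENNReal.ofReal_mul hb0.le, mul_comm b]
          refine ENNReal.ofReal_le_ofReal (mul_le_mul_of_nonneg_left ?_ (η.density_nonneg θ))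
          refine Finset.prod_le_prod (fun i _ => (div_pos (hpos i θ₀) hc).le) fun i _ => ?_
          rw [div_le_iff₀' hc]
          exact hW θ hθ _ (hs i) _
      _ = posteriorWeight ε κ η s y W := by rw [posteriorWeight, withDensity_apply _ hWm]
      _ ≤ posteriorWeight ε κ η s y Set.univ := measure_mono (Set.subset_univ _)
  have hratio : ∏ i, c ^ 2 * (marginal ε κ (s i) (y i) θ₁ / marginal ε κ (s i) (y i) θ₀)
      = b⁻¹ * a := by
    rw [ha, hb, ← Finset.prod_inv_distrib, ← Finset.prod_mul_distrib]
    refine Finset.prod_congr rfl fun i _ => ?_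
    have := (hpos i θ₀).ne'
    field_simp
  rw [posterior, Measure.smul_apply, smul_eq_mul, hratio,
    ENNReal.ofReal_mul (inv_nonneg.mpr hb0.le), ENNReal.ofReal_inv_of_pos hb0, ← mul_assoc,
    mul_comm m⁻¹]
  have hinv : (ENNReal.ofReal b)⁻¹ * m⁻¹ = (ENNReal.ofReal b * m)⁻¹ :=
    (ENNReal.mul_inv (Or.inl (ENNReal.ofReal_pos.mpr hb0).ne')
      (Or.inl ENNReal.ofReal_ne_top)).symm
  rw [hinv]
  exact mul_le_mul' (ENNReal.inv_le_inv.mpr hlower) hupper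

/-- The square root is what creates decay: under `θ₀` the ratio `h(y|θ₁) / h(y|θ₀)` has mean one,
whereas the mean of its square root is the Hellinger affinity. -/
lemma posterior_le_prod_sqrt {K : ℕ} {ε κ : ℝ} (η : Prior K) {θ₀ θ₁ : Simplex K} {c : ℝ}
    (hc : 0 < c) {V W : Set (Simplex K)} (hVm : MeasurableSet V) (hWm : MeasurableSet W)
    (hV : ∀ θ ∈ V, ∀ S ≠ Finset.univ, ∀ y, marginal ε κ S y θ ≤ c * marginal ε κ S y θ₁)
    (hW : ∀ θ ∈ W, ∀ S ≠ Finset.univ, ∀ y, marginal ε κ S y θ₀ ≤ c * marginal ε κ S y θ)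
    {ι : Type} [Fintype ι] (s : ι → Finset (Fin K)) (hs : ∀ i, s i ≠ Finset.univ)
    (y : ι → Fin K) :
    posterior ε κ η s y V ≤
      (∫⁻ θ in W, ENNReal.ofReal (η.density θ) ∂(simplexVolume K))⁻¹ ^ (1 / 2 : ℝ) *
      ∏ i, ENNReal.ofReal
        (c * √(marginal ε κ (s i) (y i) θ₁ / marginal ε κ (s i) (y i) θ₀)) := by
  have := isProbabilityMeasure_posterior ε κ η s hs y
  have hq : ∀ i, 0 ≤ marginal ε κ (s i) (y i) θ₁ / marginal ε κ (s i) (y i) θ₀ := fun i =>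
    (div_pos (marginal_pos ε κ (hs i) _ _) (marginal_pos ε κ (hs i) _ _)).le
  calc posterior ε κ η s y V = posterior ε κ η s y V ^ (1 : ℝ) := (ENNReal.rpow_one _).symm
    _ ≤ posterior ε κ η s y V ^ (1 / 2 : ℝ) :=
        ENNReal.rpow_le_rpow_of_exponent_ge prob_le_one (by norm_num)
    _ ≤ _ := ENNReal.rpow_le_rpow (posterior_le η hc hVm hWm hV hW s hs y) (by norm_num)
    _ = _ := by
        rw [ENNReal.mul_rpow_of_nonneg _ _ (by norm_num),
          ENNReal.ofReal_prod_of_nonneg fun i _ => mul_nonneg (sq_nonneg c) (hq i),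
          ← ENNReal.prod_rpow_of_nonneg (by norm_num)]
        congr 1
        refine Finset.prod_congr rfl fun i _ => ?_
        rw [ENNReal.ofReal_rpow_of_nonneg (mul_nonneg (sq_nonneg c) (hq i)) (by norm_num),
          ← Real.sqrt_eq_rpow, Real.sqrt_mul (sq_nonneg c), Real.sqrt_sq hc.le]

/-! ### Expectations along the run -/

section Run

variable {K : ℕ} {U : Simplex K → Finset (Fin K) → ℝ → ℝ} {ε κ : ℝ}

instance (κ : ℝ) (η : Prior K) (R : SelectionRule U ε) (θ θinit : Simplex K) :
    IsProbabilityMeasure (runLaw κ η R θ θinit) := by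
  unfold runLaw; infer_instance

lemma lintegral_responseKernel (R : SelectionRule U ε) (θ ϑ : Simplex K) (f : Fin K → ℝ≥0∞) :
    ∫⁻ y, f y ∂(responseKernel κ R θ ϑ)
      = ∑ y, ENNReal.ofReal (marginal ε κ (R.best ϑ) y θ) * f y := by
  change ∫⁻ y, f y ∂(responseLaw ε κ θ (R.best ϑ)) = _
  simp [responseLaw, lintegral_finsetSum_measure, lintegral_smul_measure]

lemma map_runLaw (η : Prior K) (R : SelectionRule U ε) (θ θinit : Simplex K) (n : ℕ) :
    ((runLaw κ η R θ θinit).map (Preorder.frestrictLe (π := fun _ => State K) n)) ⊗ₘ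
        stepKernel κ η R θ n =
      (runLaw κ η R θ θinit).map
        fun w => (Preorder.frestrictLe (π := fun _ => State K) n w, w (n + 1)) :=
  Kernel.map_frestrictLe_trajMeasure_compProd_eq_map_trajMeasure

/-- Tower property: the next state is integrated out given the history up to time `n`. -/
lemma lintegral_runLaw (η : Prior K) (R : SelectionRule U ε) (θ θinit : Simplex K) (n : ℕ)
    {f : (Finset.Iic n → State K) × State K → ℝ≥0∞} (hf : Measurable f) :
    ∫⁻ w, f (Preorder.frestrictLe (π := fun _ => State K) n w, w (n + 1))
        ∂(runLaw κ η R θ θinit) =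
      ∫⁻ w, ∫⁻ s, f (Preorder.frestrictLe (π := fun _ => State K) n w, s)
        ∂(stepKernel κ η R θ n (Preorder.frestrictLe (π := fun _ => State K) n w))
        ∂(runLaw κ η R θ θinit) := by
  rw [← lintegral_map (g := fun w : ℕ → State K =>
      (Preorder.frestrictLe (π := fun _ => State K) n w, w (n + 1))) hf (by fun_prop),
    ← map_runLaw, Measure.lintegral_compProd hf,
    lintegral_map hf.lintegral_kernel_prod_right' (by fun_prop)]

/-- Multiplicative functionals of the run whose one-step conditional expectations are at most `r`
decay geometrically. -/
lemma lintegral_prod_runLaw_le (η : Prior K) (R : SelectionRule U ε) (θ θinit : Simplex K)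
    {f : State K → ℝ≥0∞} (hf : Measurable f) {C r : ℝ≥0∞} (hC : ∀ s, f s ≤ C)
    (hr : ∀ ϑ, ∫⁻ y, f (ϑ, y) ∂(responseKernel κ R θ ϑ) ≤ r) (n : ℕ) :
    ∫⁻ w, ∏ i ∈ Finset.range (n + 1), f (w i) ∂(runLaw κ η R θ θinit) ≤ C * r ^ n := by
  induction n with
  | zero =>
    -- The first factor is bounded crudely by `C`, so the initial law need not be unfolded; hence `n
    -- + 1` factors give only `r ^ n`.
    calc ∫⁻ w, ∏ i ∈ Finset.range (0 + 1), f (w i) ∂(runLaw κ η R θ θinit)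
        ≤ ∫⁻ _, C ∂(runLaw κ η R θ θinit) := lintegral_mono fun w => by simpa using hC (w 0)
      _ = C * r ^ 0 := by simp
  | succ n ih =>
    set g : (Finset.Iic n → State K) → ℝ≥0∞ := fun h => ∏ i, f (h i) with hg
    have hgm : Measurable g :=
      Finset.measurable_prod _ fun i _ => hf.comp (measurable_pi_apply i)
    have hgr : ∀ w : ℕ → State K, ∏ i ∈ Finset.range (n + 1), f (w i)
        = g (Preorder.frestrictLe (π := fun _ => State K) n w) := fun w => by
      rw [hg, Nat.range_succ_eq_Iic]
      exact (Finset.prod_coe_sort (Finset.Iic n) fun i => f (w i)).symm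
    have hstep : ∀ h, ∫⁻ s, f s ∂(stepKernel κ η R θ n h) ≤ r := fun h => by
      rw [stepKernel, Kernel.lintegral_compProd _ _ _ hf]
      calc _ ≤ ∫⁻ _, r ∂(samplingKernel κ η R n h) := lintegral_mono fun ϑ => hr ϑ
        _ = r := by simp
    simp_rw [Finset.prod_range_succ _ (n + 1), hgr]
    rw [lintegral_runLaw η R θ θinit n (f := fun p => g p.1 * f p.2)
      ((hgm.comp measurable_fst).mul (hf.comp measurable_snd))]
    calc _ ≤ ∫⁻ w, g (Preorder.frestrictLe (π := fun _ => State K) n w) * r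
          ∂(runLaw κ η R θ θinit) := lintegral_mono fun w => by
            simp only
            rw [lintegral_const_mul _ hf]
            gcongr
            exact hstep _
      _ = (∫⁻ w, ∏ i ∈ Finset.range (n + 1), f (w i) ∂(runLaw κ η R θ θinit)) * r := by
          simp_rw [hgr]
          exact lintegral_mul_const _ (hgm.comp (by fun_prop))
      _ ≤ C * r ^ n * r := by gcongr
      _ = C * r ^ (n + 1) := by rw [pow_succ, mul_assoc]

/-- The sampled parameter falls into `V` with the expected posterior probability of `V`. -/
lemma runLaw_mem_eq (η : Prior K) (R : SelectionRule U ε) (θ θinit : Simplex K) (n : ℕ)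
    {V : Set (Simplex K)} (hV : MeasurableSet V) :
    runLaw κ η R θ θinit {w | (w (n + 1)).1 ∈ V} =
      ∫⁻ w, posterior ε κ η (fun i : Finset.Iic n => R.best (w i).1) (fun i => (w i).2) V
        ∂(runLaw κ η R θ θinit) := by
  have hV' : MeasurableSet {w : ℕ → State K | (w (n + 1)).1 ∈ V} :=
    (measurable_fst.comp (measurable_pi_apply (n + 1))) hV
  have hV2 : MeasurableSet {p : (Finset.Iic n → State K) × State K | p.2.1 ∈ V} :=
    (measurable_fst.comp measurable_snd) hV
  rw [← lintegral_indicator_one hV']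
  have := lintegral_runLaw (κ := κ) η R θ θinit n
    (f := Set.indicator {p | p.2.1 ∈ V} 1) (measurable_one.indicator hV2)
  refine Eq.trans ?_ (this.trans ?_)
  · rfl
  · refine lintegral_congr fun w => ?_
    -- The parameter marginal of a step is the sampling kernel, since the response kernel is Markov.
    have h1 : ∀ h : Finset.Iic n → State K, stepKernel κ η R θ n h {s | s.1 ∈ V}
        = samplingKernel κ η R n h V := fun h => by
      rw [← Kernel.fst_compProd (samplingKernel κ η R n) (Kernel.prodMkLeft
        (Finset.Iic n → State K) (responseKernel κ R θ)), Kernel.fst_apply' _ _ hV]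
      rfl
    calc _ = stepKernel κ η R θ n (Preorder.frestrictLe (π := fun _ => State K) n w)
          {s | s.1 ∈ V} := by
            exact lintegral_indicator_one (measurable_fst hV)
      _ = _ := h1 _

/-! ### Convergence of the sampled parameters -/

/-- Every wrong parameter has a neighbourhood that is asymptotically never sampled from. -/
lemma exists_nhds_tendsto_zero (hε : 0 < ε) (hκ₀ : 0 < κ) (hκ₁ : κ < 1)
    {η : Prior K} (R : SelectionRule U ε) {θ₀ : Simplex K} (θinit : Simplex K)
    (hprior : PriorCondition η θ₀) {θ₁ : Simplex K} (hne : θ₁ ≠ θ₀) :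
    ∃ V ∈ 𝓝 θ₁, Tendsto (fun n => runLaw κ η R θ₀ θinit {w | (w (n + 1)).1 ∈ V})
      atTop (𝓝 0) := by
  obtain ⟨r, hr1, hr⟩ := exists_affinity_le hε hκ₀ hκ₁ hne
  obtain ⟨c, hc1, hcr⟩ : ∃ c : ℝ, 1 < c ∧ c * r < 1 := by
    have h1 : ∀ᶠ c : ℝ in 𝓝[>] 1, c * r < 1 := nhdsWithin_le_nhds
      ((continuous_mul_const r).continuousAt.eventually_lt continuousAt_const (by simpa using hr1))
    obtain ⟨c, h, hc⟩ := (h1.and eventually_mem_nhdsWithin).exists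
    exact ⟨c, hc, h⟩
  have hc0 : 0 < c := one_pos.trans hc1
  -- Only finitely many pairs `(S, y)` occur, so the set is a finite intersection of open sets.
  have hopen : ∀ F G : Finset (Fin K) → Fin K → Simplex K → ℝ, (∀ S y, Continuous (F S y)) →
      (∀ S y, Continuous (G S y)) →
      IsOpen {θ | ∀ S ≠ Finset.univ, ∀ y, F S y θ < G S y θ} := fun F G hF hG => by
    simp only [Set.ofPred_forall]
    exact isOpen_iInter_of_finite fun S => isOpen_iInter_of_finite fun _ =>
      isOpen_iInter_of_finite fun y => isOpen_lt (hF S y) (hG S y)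
  set V : Set (Simplex K) := {θ | ∀ S ≠ Finset.univ, ∀ y,
    marginal ε κ S y θ < c * marginal ε κ S y θ₁}
  set W : Set (Simplex K) := {θ | ∀ S ≠ Finset.univ, ∀ y,
    marginal ε κ S y θ₀ < c * marginal ε κ S y θ}
  have hVo : IsOpen V := hopen _ _ (continuous_marginal ε κ) fun _ _ => continuous_const
  have hWo : IsOpen W := hopen _ _ (fun _ _ => continuous_const) fun S y =>
    (continuous_marginal ε κ S y).const_mul c
  have hself : ∀ θ : Simplex K, ∀ S ≠ Finset.univ, ∀ y, marginal ε κ S y θ < c * marginal ε κ S y θ :=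
    fun θ S hS y => lt_mul_of_one_lt_left (marginal_pos ε κ hS y θ) hc1
  have hW0 := hprior.setLIntegral_density_pos (hWo.mem_nhds (hself θ₀))
  set m := ∫⁻ θ in W, ENNReal.ofReal (η.density θ) ∂(simplexVolume K)
  refine ⟨V, hVo.mem_nhds (hself θ₁), ?_⟩
  set φ : Finset (Fin K) × Fin K → ℝ≥0∞ := fun p =>
    ENNReal.ofReal (c * √(marginal ε κ p.1 p.2 θ₁ / marginal ε κ p.1 p.2 θ₀)) with hφ
  set f : State K → ℝ≥0∞ := fun s => φ (R.best s.1, s.2) with hf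
  have hfm : Measurable f := (measurable_of_countable φ).comp
    ((R.measurable_topSet.comp measurable_fst).prodMk measurable_snd)
  set C : ℝ≥0∞ := ∑ p, φ p
  have hCtop : C ≠ ⊤ := ENNReal.sum_ne_top.mpr fun p _ => ENNReal.ofReal_ne_top
  have hfC : ∀ s, f s ≤ C := fun s =>
    Finset.single_le_sum (f := φ) (fun _ _ => zero_le) (Finset.mem_univ _)
  have hfr : ∀ ϑ, ∫⁻ y, f (ϑ, y) ∂(responseKernel κ R θ₀ ϑ) ≤ ENNReal.ofReal (c * r) := by
    intro ϑ
    have hS := R.best_ne_univ ϑ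
    rw [lintegral_responseKernel]
    -- Weighting `√(h₁ / h₀)` by `h₀` gives `√(h₁ h₀)`, so the conditional mean becomes `c` times
    -- the affinity.
    have hterm : ∀ y, ENNReal.ofReal (marginal ε κ (R.best ϑ) y θ₀) * f (ϑ, y) =
        ENNReal.ofReal (c * √(marginal ε κ (R.best ϑ) y θ₁ * marginal ε κ (R.best ϑ) y θ₀)) := by
      intro y
      have h0 := marginal_pos ε κ hS y θ₀
      have h1 := marginal_pos ε κ hS y θ₁
      rw [hf, hφ, ← ENNReal.ofReal_mul h0.le]
      congr 1
      simp only
      rw [mul_left_comm, Real.sqrt_div h1.le, Real.sqrt_mul h1.le]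
      congr 1
      have hs := Real.sqrt_pos.mpr h0
      field_simp
      rw [Real.sq_sqrt h0.le]
    simp_rw [hterm]
    rw [← ENNReal.ofReal_sum_of_nonneg fun y _ => by positivity, ← Finset.mul_sum]
    exact ENNReal.ofReal_le_ofReal (mul_le_mul_of_nonneg_left (hr _ hS) hc0.le)
  have hbound : ∀ n, runLaw κ η R θ₀ θinit {w | (w (n + 1)).1 ∈ V} ≤
      m⁻¹ ^ (1 / 2 : ℝ) * C * ENNReal.ofReal (c * r) ^ n := by
    intro n
    rw [runLaw_mem_eq η R θ₀ θinit n hVo.measurableSet]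
    calc _ ≤ ∫⁻ w, m⁻¹ ^ (1 / 2 : ℝ) * ∏ i ∈ Finset.range (n + 1), f (w i)
          ∂(runLaw κ η R θ₀ θinit) := by
          refine lintegral_mono fun w => ?_
          rw [Nat.range_succ_eq_Iic, ← Finset.prod_coe_sort (Finset.Iic n) fun i => f (w i)]
          exact posterior_le_prod_sqrt η hc0 hVo.measurableSet hWo.measurableSet
            (fun θ hθ S hS y => (hθ S hS y).le) (fun θ hθ S hS y => (hθ S hS y).le)
            (fun i : Finset.Iic n => R.best (w i).1) (fun _ => R.best_ne_univ _) fun i => (w i).2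
      _ = m⁻¹ ^ (1 / 2 : ℝ) * ∫⁻ w, ∏ i ∈ Finset.range (n + 1), f (w i)
          ∂(runLaw κ η R θ₀ θinit) := lintegral_const_mul _
            (Finset.measurable_prod _ fun i _ => hfm.comp (measurable_pi_apply i))
      _ ≤ m⁻¹ ^ (1 / 2 : ℝ) * (C * ENNReal.ofReal (c * r) ^ n) := by
          gcongr
          exact lintegral_prod_runLaw_le η R θ₀ θinit hfm hfC hfr n
      _ = _ := (mul_assoc _ _ _).symm
  have htop : m⁻¹ ^ (1 / 2 : ℝ) * C ≠ ⊤ := ENNReal.mul_ne_top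
    (ENNReal.rpow_ne_top_of_nonneg (by norm_num) (ENNReal.inv_ne_top.mpr hW0.ne')) hCtop
  have hlim : Tendsto (fun n => m⁻¹ ^ (1 / 2 : ℝ) * C * ENNReal.ofReal (c * r) ^ n) atTop
      (𝓝 0) := by
    have := ENNReal.Tendsto.const_mul (a := m⁻¹ ^ (1 / 2 : ℝ) * C)
      (ENNReal.tendsto_pow_atTop_nhds_zero_of_lt_one
        (ENNReal.ofReal_lt_one.mpr hcr)) (Or.inr htop)
    rwa [mul_zero] at this
  exact tendsto_of_tendsto_of_tendsto_of_le_of_le tendsto_const_nhds hlim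
    (fun _ => zero_le) hbound

/-- The sampled parameters converge to the true parameter in probability. -/
lemma tendsto_runLaw_mem_nhds (hε : 0 < ε) (hκ₀ : 0 < κ) (hκ₁ : κ < 1)
    {η : Prior K} (R : SelectionRule U ε) {θ₀ : Simplex K} (θinit : Simplex K)
    (hprior : PriorCondition η θ₀) {A : Set (Simplex K)} (hA : A ∈ 𝓝 θ₀) :
    Tendsto (fun n => runLaw κ η R θ₀ θinit {w | (w (n + 1)).1 ∉ A}) atTop (𝓝 0) := by
  have hcomp : IsCompact (interior A)ᶜ := isOpen_interior.isClosed_compl.isCompact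
  have hmain : Tendsto (fun n => runLaw κ η R θ₀ θinit {w | (w (n + 1)).1 ∈ (interior A)ᶜ})
      atTop (𝓝 0) := by
    -- Asymptotic negligibility passes to subsets and finite unions, so the local statement suffices
    -- on a compact set.
    refine hcomp.induction_on (p := fun B =>
      Tendsto (fun n => runLaw κ η R θ₀ θinit {w | (w (n + 1)).1 ∈ B}) atTop (𝓝 0)) ?_ ?_ ?_ ?_
    · simp
    · exact fun B B' hB h => tendsto_of_tendsto_of_tendsto_of_le_of_le tendsto_const_nhds h
        (fun _ => zero_le) fun n => measure_mono fun w hw => hB hw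
    · intro B B' h h'
      have := h.add h'
      rw [add_zero] at this
      exact tendsto_of_tendsto_of_tendsto_of_le_of_le tendsto_const_nhds this
        (fun _ => zero_le) fun n => measure_union_le _ _
    · intro θ₁ hθ₁
      have hne : θ₁ ≠ θ₀ := fun h => hθ₁ (h ▸ mem_interior_iff_mem_nhds.mpr hA)
      obtain ⟨V, hV, hlim⟩ := exists_nhds_tendsto_zero hε hκ₀ hκ₁ R θinit hprior hne
      exact ⟨V, nhdsWithin_le_nhds hV, hlim⟩
  exact tendsto_of_tendsto_of_tendsto_of_le_of_le tendsto_const_nhds hmain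
    (fun _ => zero_le) fun n => measure_mono fun w hw h => hw (interior_subset h)

lemma measurableSet_selected_eq (R : SelectionRule U ε) (t : ℕ) (S : Finset (Fin K)) :
    MeasurableSet {w : ℕ → State K | selected R t w = S} :=
  (R.measurable_topSet.comp (measurable_fst.comp (measurable_pi_apply (t - 1))))
    (measurableSet_singleton S)

end Run

end AdOBEst

/-! ### Selection probability and long-run frequency -/

open AdOBEst

/-- If the prior condition holds at `θstar`, the components of `θstar` are strictly ordered, the
utility is continuous in the parameter for every proper subset, and the optimal `k` at `θstar` is
unique, then under exact posterior sampling the best subset is selected with probability tending to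
one, hence with expected long-run frequency one. -/
theorem mainTheorem2 {K : ℕ} (ε κ : ℝ) (hε : 0 < ε) (hκ₀ : 0 < κ) (hκ₁ : κ < 1)
    (U : AdOBEst.Simplex K → Finset (Fin K) → ℝ → ℝ)
    (R : AdOBEst.SelectionRule U ε) (η : AdOBEst.Prior K) (θstar θinit : AdOBEst.Simplex K)
    (hprior : AdOBEst.PriorCondition η θstar)
    (horder : StrictAnti fun i => θstar (R.σ θstar i))
    (hcont : ∀ S : Finset (Fin K), S ≠ Finset.univ → Continuous fun θ => U θ S ε)
    (hunique : ∃! k : Fin K, ∀ j : Fin K,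
      U θstar (AdOBEst.topSet (R.σ θstar) j) ε ≤ U θstar (AdOBEst.topSet (R.σ θstar) k) ε) :
    Tendsto (fun n : ℕ => (AdOBEst.runLaw κ η R θstar θinit).real
        {w | AdOBEst.selected R n w = R.best θstar}) atTop (𝓝 1) ∧
    Tendsto (fun n : ℕ => (1 / (n : ℝ)) * ∑ t ∈ Finset.Icc 1 n,
        ∫ w, Set.indicator {w | AdOBEst.selected R t w = R.best θstar} (fun _ => (1 : ℝ)) w
          ∂(AdOBEst.runLaw κ η R θstar θinit)) atTop (𝓝 1) := by
  have hprob : Tendsto (fun n : ℕ => (runLaw κ η R θstar θinit).real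
      {w | selected R n w = R.best θstar}) atTop (𝓝 1) := by
    -- The subset at time `n + 2` is computed from `Θ_{n+1}`, the first coordinate of state `n + 1`.
    rw [← tendsto_add_atTop_iff_nat 2]
    have hlim := tendsto_runLaw_mem_nhds hε hκ₀ hκ₁ R θinit hprior
      (R.eventually_best_eq horder hcont hunique)
    have hreal := ((ENNReal.tendsto_toReal ENNReal.zero_ne_top).comp hlim).const_sub 1
    rw [ENNReal.toReal_zero, sub_zero] at hreal
    refine hreal.congr fun n => ?_
    rw [← compl_compl {w : ℕ → State K | selected R (n + 2) w = R.best θstar},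
      probReal_compl_eq_one_sub (measurableSet_selected_eq R _ _).compl]
    rfl
  refine ⟨hprob, ?_⟩
  -- The Cesàro mean runs over `0, …, n - 1`, so the sequence is shifted to match times `1, …, n`.
  have hces := ((tendsto_add_atTop_iff_nat 1).mpr hprob).cesaro
  refine hces.congr fun n => ?_
  have hIcc : Finset.Icc 1 n = Finset.Ico (0 + 1) (n + 1) := by
    ext t
    simp only [Finset.mem_Icc, Finset.mem_Ico]
    omega
  rw [one_div, hIcc, ← Finset.sum_Ico_add', ← Finset.range_eq_Ico]
  congr 1
  refine Finset.sum_congr rfl fun t _ => ?_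
  exact (integral_indicator_one (measurableSet_selected_eq R _ _)).symm


end
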